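/- Let $T=\mathbb F_2^{\oplus\mathbb N}$ be the set of finitely supported $0$–$1$ sequences, and let $\Gamma$ be the group of permutations of $T$ generated by the finitely supported permutations of the coordinate set $\mathbb N$ and the bit-flips $x\mapsto x+e_i$ $(i\in\mathbb N)$. For a measurable space $K$, a probability measure $\mu$ on $K^T$ is called exchangeable if it is invariant under the maps $(\omega_t)_{t\in T}\mapsto(\omega_{\gamma(t)})_{t\in T}$ for all $\gamma\in\Gamma$. A list of index data consists of sets $T_1,T_2,\dots$ (possibly empty), each with an action of $\Gamma$ that has only infinite orbits, and of maps $\phi_i$ from $T$ to the finite subsets of $T_i$ with $\phi_i(\gamma(t))=\gamma(\phi_i(t))$ for all $\gamma\in\Gamma$, $t\in T$. Say that $\mu$ is representable with this data if there are probability kernels $$\kappa_t:[0,1]\times[0,1]^{\phi_1(t)}\times[0,1]^{\phi_2(t)}\times\cdots\rightsquigarrow K\qquad(t\in T)$$ that are covariant, that is, $$\kappa_{\gamma(t)}\bigl(x_0,(x_i(r))_{r\in\phi_i(\gamma(t)),\,i\ge1},\,\cdot\,\bigr)=\kappa_t\bigl(x_0,(x_i(\gamma(s)))_{s\in\phi_i(t),\,i\ge1},\,\cdot\,\bigr)\qquad(\gamma\in\Gamma,\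 t\in T),$$ such that $$\mu=\int\ \bigotimes_{t\in T}\kappa_t\bigl(x_0,x_1|_{\phi_1(t)},x_2|_{\phi_2(t)},\dots,\,\cdot\,\bigr)\ \mathrm d\lambda(x_0,x_1,x_2,\dots),$$ where $\lambda$ is the product of Lebesgue measure on $[0,1]$ with its powers on $[0,1]^{T_1},[0,1]^{T_2},\dots$ **Corollary 4.3 (Failure of cube-exchangeable representability).** The exchangeable laws on $[0,1]^T$ do not all admit representation: there is an exchangeable probability measure $\mu$ on $[0,1]^T$ that is not representable with any list of index data. In particular, no single list of index data represents all exchangeable laws on $[0,1]^T$. -/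

import Mathlib

open MeasureTheory ProbabilityTheory
open scoped unitInterval

universe u v w

namespace CubeExchangeable

/-! ### Exchangeable laws -/

/-- `μ` is a `(T, Γ)`-exchangeable law on `K ^ T`: a probability measure that is invariant under
the coordinate-permuting maps `τ ^ γ : (ω_t)_t ↦ (ω_{γ t})_t`. -/
def IsExchangeable (Γ : Type*) {T K : Type*} [Group Γ] [MulAction Γ T] [MeasurableSpace K]
    (μ : Measure (T → K)) : Prop :=
  IsProbabilityMeasure μ ∧
    ∀ γ : Γ, μ.map (fun (ω : T → K) (t : T) => ω (γ • t)) = μ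

/-! ### Representation data -/

/-- Auxiliary index sets `T_1, T_2, …` (here `Idx 0, Idx 1, …`), each with an action of `Γ` that
has only infinite orbits, together with `Γ`-covariant dependency maps `dep i` from `T` to the
finite subsets of `Idx i`. An index set may be empty, and it need not be countable. The index sets
are distinct types, so subsets of different ones are automatically disjoint. -/
structure IndexData (Γ : Type v) (T : Type w) [Group Γ] [MulAction Γ T] where
  /-- the auxiliary index sets -/
  Idx : ℕ → Type u
  /-- the action of `Γ` on each of them -/
  act : ∀ i, MulAction Γ (Idx i)
  infinite_orbit : ∀ i (s : Idx i), (MulAction.orbit Γ s).Infinite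
  /-- the dependency maps -/
  dep : ∀ i, T → Finset (Idx i)
  covariant : ∀ i (γ : Γ) (t : T),
    dep i (γ • t) = (dep i t).map (MulAction.toPerm γ : Equiv.Perm (Idx i)).toEmbedding

attribute [instance] IndexData.act

section

variable {Γ : Type v} {T : Type w} [Group Γ] [MulAction Γ T]

theorem IndexData.smul_mem (D : IndexData.{u} Γ T) {i : ℕ} (γ : Γ) {t : T} {s : D.Idx i}
    (hs : s ∈ D.dep i t) : γ • s ∈ D.dep i (γ • t) := by
  rw [D.covariant]
  exact Finset.mem_map_of_mem _ hs

/-- The global parameter space `[0,1] × [0,1]^{T_1} × [0,1]^{T_2} × ⋯`. -/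
abbrev IndexData.Params (D : IndexData.{u} Γ T) : Type u :=
  I × (∀ i, D.Idx i → I)

/-- The local parameter space `[0,1] × [0,1]^{φ_1(t)} × [0,1]^{φ_2(t)} × ⋯`. -/
abbrev IndexData.LocalParams (D : IndexData.{u} Γ T) (t : T) : Type u :=
  I × (∀ i, D.dep i t → I)

/-- Restriction `(x_0, x_1, …) ↦ (x_0, x_1|_{φ_1(t)}, …)`. -/
def IndexData.restrict (D : IndexData.{u} Γ T) (t : T) (x : D.Params) : D.LocalParams t :=
  (x.1, fun i s => x.2 i s.1)

theorem IndexData.measurable_restrict (D : IndexData.{u} Γ T) (t : T) :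
    Measurable (D.restrict t) := by
  unfold IndexData.restrict
  fun_prop

/-- The map `id × τ_1^γ × τ_2^γ × ⋯`, taking `(x_0, (x_i(r))_{r ∈ φ_i(γ t)})` to
`(x_0, (x_i(γ s))_{s ∈ φ_i(t)})`. -/
def IndexData.shift (D : IndexData.{u} Γ T) (γ : Γ) (t : T) (x : D.LocalParams (γ • t)) :
    D.LocalParams t :=
  (x.1, fun i s => x.2 i ⟨γ • s.1, D.smul_mem γ s.2⟩)

/-- The law of independent uniform variables: Lebesgue measure on `[0,1]`, times its powers over
`T_1`, `T_2`, … -/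
noncomputable def IndexData.uniform (D : IndexData.{u} Γ T) : Measure D.Params :=
  (volume : Measure I).prod
    (Measure.infinitePi fun i => Measure.infinitePi fun _ : D.Idx i => (volume : Measure I))

/-- A `Γ`-covariant family of probability kernels
`κ_t : [0,1] × [0,1]^{φ_1(t)} × [0,1]^{φ_2(t)} × ⋯ ⇝ K`. -/
structure KernelFamily (D : IndexData.{u} Γ T) (K : Type*) [MeasurableSpace K] where
  ker : ∀ t, Kernel (D.LocalParams t) K
  markov : ∀ t, IsMarkovKernel (ker t)
  covariant : ∀ (γ : Γ) (t : T) (x : D.LocalParams (γ • t)),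
    ker (γ • t) x = ker t (D.shift γ t x)

attribute [instance] KernelFamily.markov

/-- The kernel `κ^{(T)} = ⨂_t κ_t` from the global parameter space to `K ^ T`: given the
parameters, the coordinates are independent, the one at `t` having law
`κ_t(x_0, x_1|_{φ_1(t)}, …)`. -/
noncomputable def KernelFamily.total {D : IndexData.{u} Γ T} {K : Type*} [MeasurableSpace K]
    (κ : KernelFamily D K) : Kernel D.Params (T → K) where
  toFun x := Measure.infinitePi fun t => κ.ker t (D.restrict t x)
  measurable' := by
    refine Measurable.measure_of_isPiSystem_of_isProbabilityMeasure
      (generateFrom_squareCylinders (α := fun _ : T => K)).symm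
      (isPiSystem_squareCylinders (fun _ => MeasurableSpace.isPiSystem_measurableSet)
        (fun _ => MeasurableSet.univ)) ?_
    rintro _ ⟨s, A, hA, rfl⟩
    have hA' : ∀ t, MeasurableSet (A t) := fun t => hA t (Set.mem_univ t)
    simp only [Measure.infinitePi_pi _ (fun t _ => hA' t)]
    exact Finset.measurable_prod _ fun t _ =>
      ((κ.ker t).measurable_coe (hA' t)).comp (D.measurable_restrict t)

/-- `μ` is representable with the index sets and dependency maps `D`: it is the image of the
independent uniform process under `κ^{(T)}` for some covariant family of probability kernels. -/
def RepresentableWith (D : IndexData.{u} Γ T) {K : Type*} [MeasurableSpace K]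
    (μ : Measure (T → K)) : Prop :=
  ∃ κ : KernelFamily D K, μ = D.uniform.bind κ.total

end

/-! ### The infinite-dimensional discrete cube -/

/-- The cube: finitely supported strings of elements of the two-element field. -/
abbrev Cube : Type := ℕ →₀ ZMod 2

/-- The permutation of the cube induced by a permutation of the coordinates. -/
def coordPerm (π : Equiv.Perm ℕ) : Equiv.Perm Cube :=
  (Finsupp.domCongr π : Cube ≃+ Cube).toEquiv

/-- The bit-flip `x ↦ x + e_i`. -/
noncomputable def bitFlip (i : ℕ) : Equiv.Perm Cube :=
  Equiv.addRight (Finsupp.single i 1)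

/-- The isometry group of the cube, generated by the finitely supported permutations of the
coordinates and all bit-flips. -/
def cubeIsom : Subgroup (Equiv.Perm Cube) :=
  Subgroup.closure
    ({g | ∃ π : Equiv.Perm ℕ, {n | π n ≠ n}.Finite ∧ g = coordPerm π} ∪ Set.range bitFlip)

end CubeExchangeable

/-!
The law of a uniformly random proper `2`-coloring of the cube is exchangeable, since every isometry
either preserves or reverses the parity of all vertices, and it is not representable, because
neighbouring vertices are negatively correlated.

For any index data, the dependency sets of two neighbouring vertices are disjoint
(`IndexData.disjoint_dep`). The set `A = φ_i(0)` is finite and invariant under the coordinate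
permutations, so the permutations fixing it pointwise form a nontrivial normal subgroup, which
contains, for every `j ≠ 0`, an element sending `j` to `0` (`exists_coordPerm_fixing`). If `s` lies
both in `A` and in its translate by the bit-flip `e_0`, commuting such a permutation with `e_0` shows that `e_j + e_0` fixes `s` for every `j`
(`flipIsom_smul_eq`). Then the orbit of `s` is finite (`orbit_finite`), which index data exclude.

Hence, in a represented law, the colors of two neighbours are independent given the global
variable `x₀`, and covariance of the kernels gives them the same conditional law. The probability
that both lie in a set `S` is therefore `∫ g²`, where `g x₀` is the conditional probability that
one of them does, while that of one of them lying in `S` is `∫ g`; if the former vanishes, so does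
the latter (`RepresentableWith.measure_eval_eq_zero`). For the random coloring and
`S = {0}` the former is `0` and the latter is `1/2`.
-/

namespace CubeExchangeable

/-! ### Isometries of the cube -/

theorem coordPerm_mul (π ρ : Equiv.Perm ℕ) : coordPerm (π * ρ) = coordPerm π * coordPerm ρ := by
  ext x n
  simp only [coordPerm, Finsupp.domCongr, Equiv.Perm.mul_apply]
  rfl

theorem coordPerm_mul_bitFlip (π : Equiv.Perm ℕ) (i : ℕ) :
    coordPerm π * bitFlip i = bitFlip (π i) * coordPerm π := by
  ext x n
  simp [coordPerm, bitFlip, Finsupp.domCongr, Finsupp.equivMapDomain_apply, Finsupp.single_apply,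
    Equiv.eq_symm_apply]

/-- The bit-flip at `i`, as an element of the isometry group. -/
noncomputable def flipIsom (i : ℕ) : cubeIsom :=
  ⟨bitFlip i, Subgroup.subset_closure (Or.inr ⟨i, rfl⟩)⟩

/-- The transposition of the coordinates `i` and `j`, as an element of the isometry group. -/
noncomputable def swapIsom (i j : ℕ) : cubeIsom :=
  ⟨coordPerm (Equiv.swap i j), Subgroup.subset_closure (Or.inl ⟨_, by
    refine (Set.toFinite {i, j}).subset fun n hn => ?_
    by_contra h
    simp only [Set.mem_insert_iff, Set.mem_singleton_iff, not_or] at h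
    exact hn (Equiv.swap_apply_of_ne_of_ne h.1 h.2), rfl⟩)⟩

theorem flipIsom_mul_self (i : ℕ) : flipIsom i * flipIsom i = 1 := by
  ext x n
  simp [flipIsom, bitFlip, add_assoc, ← Finsupp.single_add, CharTwo.add_self_eq_zero]

theorem flipIsom_mul_comm (i j : ℕ) : flipIsom i * flipIsom j = flipIsom j * flipIsom i := by
  ext x n
  simp [flipIsom, bitFlip, add_right_comm]

theorem mul_flipIsom {γ : cubeIsom} {π : Equiv.Perm ℕ}
    (h : (γ : Equiv.Perm Cube) = coordPerm π) (i : ℕ) :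
    γ * flipIsom i = flipIsom (π i) * γ := by
  apply Subtype.ext
  simp [flipIsom, h, coordPerm_mul_bitFlip]

theorem smul_zero_of_eq_coordPerm {γ : cubeIsom} {π : Equiv.Perm ℕ}
    (h : (γ : Equiv.Perm Cube) = coordPerm π) : γ • (0 : Cube) = 0 := by
  rw [Subgroup.smul_def, h]
  simp [coordPerm]

/-! ### Actions of the isometry group -/

section Action

open scoped Pointwise

variable {X : Type*} [MulAction cubeIsom X]

theorem flipIsom_smul_smul_self (i : ℕ) (x : X) : flipIsom i • flipIsom i • x = x := by
  rw [smul_smul, flipIsom_mul_self, one_smul]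

theorem flipIsom_smul_comm (i j : ℕ) (x : X) :
    flipIsom i • flipIsom j • x = flipIsom j • flipIsom i • x := by
  rw [smul_smul, flipIsom_mul_comm, mul_smul]

theorem smul_flipIsom_smul {γ : cubeIsom} {π : Equiv.Perm ℕ}
    (h : (γ : Equiv.Perm Cube) = coordPerm π) (i : ℕ) (x : X) :
    γ • flipIsom i • x = flipIsom (π i) • γ • x := by
  rw [smul_smul, mul_flipIsom h, mul_smul]

/-- The kernel of the action of the coordinate permutations on a finite set is normal and, by the
pigeonhole principle, nontrivial; hence any nonzero coordinate is sent to `0` by one of its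
elements. -/
theorem exists_coordPerm_fixing {A : Set X} (hA : A.Finite)
    (hinv : ∀ i j, ∀ a ∈ A, swapIsom i j • a ∈ A) {j : ℕ} (hj : j ≠ 0) :
    ∃ (γ : cubeIsom) (π : Equiv.Perm ℕ), (γ : Equiv.Perm Cube) = coordPerm π ∧ π j = 0 ∧
      ∀ a ∈ A, γ • a = a := by
  have swap_swap : ∀ (i k : ℕ) (x : X), swapIsom i k • swapIsom i k • x = x := fun i k x => by
    have : swapIsom i k * swapIsom i k = 1 := by
      apply Subtype.ext
      change coordPerm _ * coordPerm _ = 1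
      rw [← coordPerm_mul, Equiv.swap_mul_self]
      ext x n
      rfl
    rw [smul_smul, this, one_smul]
  have := hA.to_subtype
  obtain ⟨n, m, hnm, h⟩ := Finite.exists_ne_map_eq_of_infinite
    fun (n : ℕ) (a : A) => (⟨swapIsom 0 (n + 1) • a.1, hinv _ _ _ a.2⟩ : A)
  have h' : ∀ a ∈ A, swapIsom 0 (n + 1) • a = swapIsom 0 (m + 1) • a := fun a ha =>
    congrArg Subtype.val (congrFun h ⟨a, ha⟩)
  -- The three-cycle fixes `A` pointwise and sends `n + 1` to `0`; its conjugate sends `j` to `0`.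
  refine ⟨swapIsom (n + 1) j * (swapIsom 0 (n + 1) * swapIsom 0 (m + 1)) * swapIsom (n + 1) j,
    Equiv.swap (n + 1) j * (Equiv.swap 0 (n + 1) * Equiv.swap 0 (m + 1)) * Equiv.swap (n + 1) j,
    ?_, ?_, fun a ha => ?_⟩
  · simp [swapIsom, coordPerm_mul]
  · have h1 : Equiv.swap 0 (m + 1) (n + 1) = n + 1 :=
      Equiv.swap_apply_of_ne_of_ne (by omega) (by omega)
    have h2 : Equiv.swap (n + 1) j 0 = 0 := Equiv.swap_apply_of_ne_of_ne (by omega) (by omega)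
    simp [h1, h2]
  · rw [mul_smul, mul_smul, mul_smul, ← h' _ (hinv _ _ _ ha), swap_swap, swap_swap]

/-- An element common to a finite permutation-invariant set and its translate by a bit-flip does
not distinguish between the bit-flips. -/
theorem flipIsom_smul_eq {A : Set X} (hA : A.Finite)
    (hinv : ∀ i j, ∀ a ∈ A, swapIsom i j • a ∈ A) {s : X} (hs : s ∈ A)
    (hs' : flipIsom 0 • s ∈ A) (j : ℕ) : flipIsom j • s = flipIsom 0 • s := by
  rcases eq_or_ne j 0 with rfl | hj
  · rfl
  obtain ⟨γ, π, hγ, hπ, hfix⟩ := exists_coordPerm_fixing hA hinv hj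
  have h : γ • flipIsom j • flipIsom 0 • s = s := by
    rw [smul_flipIsom_smul hγ, hπ, hfix _ hs', flipIsom_smul_smul_self]
  have h' : flipIsom j • flipIsom 0 • s = s := smul_left_cancel γ (h.trans (hfix s hs).symm)
  rw [← flipIsom_smul_smul_self j (flipIsom 0 • s), h']

/-- A point of a finite permutation-invariant set which the bit-flips move all alike has a finite
orbit: together with their translates by one bit-flip, such points form an invariant set. -/
theorem orbit_finite {A : Set X} (hA : A.Finite)
    (hinv : ∀ (γ : cubeIsom) (π : Equiv.Perm ℕ), (γ : Equiv.Perm Cube) = coordPerm π →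
      ∀ a ∈ A, γ • a ∈ A) {s : X} (hs : s ∈ A)
    (hflip : ∀ j, flipIsom j • s = flipIsom 0 • s) : (MulAction.orbit cubeIsom s).Finite := by
  let B : Set X := {a | a ∈ A ∧ ∀ j, flipIsom j • a = flipIsom 0 • a}
  let C : Set X := B ∪ (fun a => flipIsom 0 • a) '' B
  have hB : B.Finite := hA.subset fun a ha => ha.1
  have hC : C.Finite := hB.union (hB.image _)
  have hperm : ∀ (γ : cubeIsom) (π : Equiv.Perm ℕ), (γ : Equiv.Perm Cube) = coordPerm π →
      ∀ b ∈ B, γ • b ∈ B := by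
    intro γ π h b hb
    have key : ∀ j, flipIsom j • γ • b = γ • flipIsom 0 • b := fun j => by
      rw [← hb.2 (π.symm j), smul_flipIsom_smul h, Equiv.apply_symm_apply]
    exact ⟨hinv γ π h b hb.1, fun j => (key j).trans (key 0).symm⟩
  have hgen : ∀ γ : cubeIsom, (γ : Equiv.Perm Cube) ∈
      ({g | ∃ π : Equiv.Perm ℕ, {n | π n ≠ n}.Finite ∧ g = coordPerm π} ∪ Set.range bitFlip) →
      γ ∈ MulAction.stabilizer cubeIsom C := by
    intro γ hγ
    have hsub : ∀ c ∈ C, γ • c ∈ C := by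
      rcases hγ with ⟨π, -, h⟩ | ⟨i, h⟩
      · rintro _ (hb | ⟨b, hb, rfl⟩)
        · exact Or.inl (hperm γ π h _ hb)
        · refine Or.inr ⟨γ • b, hperm γ π h b hb, ?_⟩
          simp only [smul_flipIsom_smul h]
          exact ((hperm γ π h b hb).2 _).symm
      · obtain rfl : flipIsom i = γ := Subtype.ext h
        rintro c (hb | ⟨b, hb, rfl⟩)
        · exact Or.inr ⟨c, hb, (hb.2 i).symm⟩
        · left
          simp only
          rwa [flipIsom_smul_comm, hb.2, flipIsom_smul_smul_self]
    exact (MulAction.mem_stabilizer_set' hC).2 hsub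
  have htop : MulAction.stabilizer cubeIsom C = ⊤ := by
    rw [eq_top_iff]
    refine (Subgroup.closure_closure_coe_preimage (k := {g | ∃ π : Equiv.Perm ℕ,
      {n | π n ≠ n}.Finite ∧ g = coordPerm π} ∪ Set.range bitFlip)).ge.trans ?_
    exact (Subgroup.closure_le _).2 fun γ hγ => hgen γ hγ
  refine hC.subset ?_
  rintro _ ⟨γ, rfl⟩
  have hγ : γ • C = C := MulAction.mem_stabilizer_iff.1 (htop ▸ Subgroup.mem_top γ)
  rw [← hγ]
  exact Set.smul_mem_smul_set (Or.inl ⟨hs, hflip⟩)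

end Action

/-- The dependency sets of neighbouring vertices of the cube are disjoint. -/
theorem IndexData.disjoint_dep (D : IndexData.{u} cubeIsom Cube) (i : ℕ) :
    Disjoint (D.dep i 0) (D.dep i (flipIsom 0 • (0 : Cube))) := by
  rw [Finset.disjoint_left]
  intro s hs hs'
  have hinv : ∀ (γ : cubeIsom) (π : Equiv.Perm ℕ), (γ : Equiv.Perm Cube) = coordPerm π →
      ∀ a ∈ (D.dep i 0 : Set (D.Idx i)), γ • a ∈ (D.dep i 0 : Set (D.Idx i)) := by
    intro γ π h a ha
    have := D.smul_mem γ (Finset.mem_coe.1 ha)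
    rwa [smul_zero_of_eq_coordPerm h] at this
  have hs'' : flipIsom 0 • s ∈ D.dep i 0 := by
    have := D.smul_mem (flipIsom 0) hs'
    rwa [flipIsom_smul_smul_self] at this
  exact D.infinite_orbit i s (orbit_finite (D.dep i 0).finite_toSet hinv hs
    (flipIsom_smul_eq (D.dep i 0).finite_toSet (fun k l => hinv _ _ rfl) hs hs''))

/-! ### Conditional independence in represented laws -/

section Independence

variable {Γ : Type v} {T : Type w} [Group Γ] [MulAction Γ T] (D : IndexData.{u} Γ T)

/-- The law of the auxiliary variables, without the global one. -/
noncomputable def IndexData.auxLaw : Measure (∀ i, D.Idx i → I) :=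
  Measure.infinitePi fun i => Measure.infinitePi fun _ : D.Idx i => (volume : Measure I)

instance : IsProbabilityMeasure D.auxLaw := by
  unfold IndexData.auxLaw
  infer_instance

/-- The sigma-algebra generated by the auxiliary variables on which the coordinate `t` depends. -/
abbrev IndexData.localSigma (t : T) : MeasurableSpace (∀ i, D.Idx i → I) :=
  ⨆ p ∈ {p : Σ i, D.Idx i | p.2 ∈ D.dep p.1 t},
    MeasurableSpace.comap (fun y : ∀ i, D.Idx i → I => y p.1 p.2) inferInstance

theorem IndexData.localSigma_le (t : T) : D.localSigma t ≤ MeasurableSpace.pi :=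
  iSup₂_le fun p _ => Measurable.comap_le (by fun_prop)

/-- Auxiliary variables read at disjoint dependency sets are independent. -/
theorem IndexData.indep_localSigma {t t' : T} (h : ∀ i, Disjoint (D.dep i t) (D.dep i t')) :
    Indep (D.localSigma t) (D.localSigma t') D.auxLaw := by
  have hind : iIndepFun (fun (p : Σ i, D.Idx i) (y : ∀ i, D.Idx i → I) => y p.1 p.2) D.auxLaw :=
    iIndepFun_uncurry_infinitePi (X := fun i (j : D.Idx i) (x : I) => x)
      (fun i (_ : D.Idx i) => (volume : Measure I)) (fun _ _ => measurable_id)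
  refine indep_iSup_of_disjoint (fun p => Measurable.comap_le (by fun_prop)) hind.iIndep ?_
  rw [Set.disjoint_left]
  exact fun p hp hp' => Finset.disjoint_left.1 (h p.1) hp hp'

theorem IndexData.measurable_restrict_localSigma (t : T) (x₀ : I) :
    Measurable[D.localSigma t] fun y => D.restrict t (x₀, y) := by
  have haux : Measurable[D.localSigma t]
      fun (y : ∀ i, D.Idx i → I) i (s : D.dep i t) => y i s.1 := by
    refine (@measurable_pi_iff _ _ _ (D.localSigma t) _ _).2 fun i =>
      (@measurable_pi_iff _ _ _ (D.localSigma t) _ _).2 fun s => ?_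
    refine Measurable.mono (comap_measurable (fun y : ∀ i, D.Idx i → I => y i s.1)) ?_ le_rfl
    exact le_iSup₂ (f := fun (p : Σ i, D.Idx i) (_ : p.2 ∈ D.dep p.1 t) =>
      MeasurableSpace.comap (fun y : ∀ i, D.Idx i → I => y p.1 p.2) inferInstance)
      (⟨i, s.1⟩ : Σ i, D.Idx i) s.2
  exact (measurable_prodMk_left (x := x₀)).comp haux

/-- The law of the auxiliary variables is invariant under the action on the index sets. -/
theorem IndexData.measurePreserving_smul (γ : Γ) :
    MeasurePreserving (fun (y : ∀ i, D.Idx i → I) i s => y i (γ • s)) D.auxLaw D.auxLaw := by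
  refine ⟨by fun_prop, ?_⟩
  unfold IndexData.auxLaw
  rw [Measure.infinitePi_map_pi (f := fun i (y : D.Idx i → I) s => y (γ • s)) _
    (fun i => by fun_prop)]
  congr 1
  funext i
  exact Measure.map_infinitePi_infinitePi_of_inj (P := fun _ : D.Idx i => (volume : Measure I))
    (MulAction.injective γ)

variable {D} {K : Type*} [MeasurableSpace K]

/-- The probability that the coordinate `t` lies in `S`, given the global variable. -/
noncomputable def KernelFamily.condProb (κ : KernelFamily D K) (S : Set K) (t : T) (x₀ : I) :
    ENNReal :=
  ∫⁻ y, κ.ker t (D.restrict t (x₀, y)) S ∂D.auxLaw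

/-- Covariance of the kernels makes the coordinates identically distributed given the global
variable. -/
theorem KernelFamily.condProb_smul (κ : KernelFamily D K) {S : Set K} (hS : MeasurableSet S)
    (γ : Γ) (t : T) (x₀ : I) : κ.condProb S (γ • t) x₀ = κ.condProb S t x₀ := by
  unfold KernelFamily.condProb
  have hm : Measurable fun y => κ.ker t (D.restrict t (x₀, y)) S :=
    ((κ.ker t).measurable_coe hS).comp ((D.measurable_restrict t).comp measurable_prodMk_left)
  rw [← (D.measurePreserving_smul γ).lintegral_comp hm]
  simp only [κ.covariant]
  rfl

theorem KernelFamily.bind_total_eval_mem (κ : KernelFamily D K) {S : Set K}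
    (hS : MeasurableSet S) (t : T) :
    (D.uniform.bind κ.total) {ω | ω t ∈ S} = ∫⁻ x₀, κ.condProb S t x₀ := by
  have hm : ∀ t, Measurable fun x => κ.ker t (D.restrict t x) S := fun t =>
    ((κ.ker t).measurable_coe hS).comp (D.measurable_restrict t)
  have hset : MeasurableSet {ω : T → K | ω t ∈ S} := measurable_pi_apply t hS
  rw [Measure.bind_apply hset κ.total.measurable.aemeasurable]
  change _ = ∫⁻ x₀, ∫⁻ y, _ ∂D.auxLaw
  rw [← lintegral_prod _ (hm t).aemeasurable]
  refine lintegral_congr fun x => ?_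
  exact (measurePreserving_eval_infinitePi (fun t => κ.ker t (D.restrict t x)) t).measure_preimage
    hS.nullMeasurableSet

/-- Coordinates with disjoint dependency sets are conditionally independent given the global
variable. -/
theorem KernelFamily.bind_total_eval_mem_inter (κ : KernelFamily D K) {S : Set K}
    (hS : MeasurableSet S) {t t' : T} (hne : t ≠ t')
    (h : ∀ i, Disjoint (D.dep i t) (D.dep i t')) :
    (D.uniform.bind κ.total) {ω | ω t ∈ S ∧ ω t' ∈ S} =
      ∫⁻ x₀, κ.condProb S t x₀ * κ.condProb S t' x₀ := by
  classical
  have hm : ∀ t, Measurable fun x => κ.ker t (D.restrict t x) S := fun t =>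
    ((κ.ker t).measurable_coe hS).comp (D.measurable_restrict t)
  have hset : {ω : T → K | ω t ∈ S ∧ ω t' ∈ S} =
      (({t, t'} : Finset T) : Set T).pi fun _ => S := by
    ext ω
    simp
  rw [Measure.bind_apply _ κ.total.measurable.aemeasurable]
  · have : ∀ x, κ.total x {ω | ω t ∈ S ∧ ω t' ∈ S} =
        κ.ker t (D.restrict t x) S * κ.ker t' (D.restrict t' x) S := fun x => by
      change Measure.infinitePi (fun t => κ.ker t (D.restrict t x)) _ = _
      rw [hset, Measure.infinitePi_pi _ (fun _ _ => hS), Finset.prod_pair hne]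
    simp only [this]
    change ∫⁻ x, _ ∂(volume.prod D.auxLaw) = _
    rw [lintegral_prod (fun x => κ.ker t (D.restrict t x) S * κ.ker t' (D.restrict t' x) S)
      ((hm t).mul (hm t')).aemeasurable]
    refine lintegral_congr fun x₀ => ?_
    exact lintegral_mul_eq_lintegral_mul_lintegral_of_independent_measurableSpace
      (D.localSigma_le t) (D.localSigma_le t') (D.indep_localSigma h)
      (((κ.ker t).measurable_coe hS).comp (D.measurable_restrict_localSigma t x₀))
      (((κ.ker t').measurable_coe hS).comp (D.measurable_restrict_localSigma t' x₀))
  · exact (measurable_pi_apply t hS).inter (measurable_pi_apply t' hS)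

/-- Two coordinates in the same orbit with disjoint dependency sets are conditionally i.i.d., so
if they almost surely do not both lie in `S`, then almost surely neither does. -/
theorem RepresentableWith.measure_eval_eq_zero {μ : Measure (T → K)} (hμ : RepresentableWith D μ)
    {S : Set K} (hS : MeasurableSet S) {γ : Γ} {t : T} (hne : t ≠ γ • t)
    (h : ∀ i, Disjoint (D.dep i t) (D.dep i (γ • t)))
    (hzero : μ {ω | ω t ∈ S ∧ ω (γ • t) ∈ S} = 0) : μ {ω | ω t ∈ S} = 0 := by
  obtain ⟨κ, rfl⟩ := hμ
  have hm : Measurable (κ.condProb S t) := Measurable.lintegral_prod_right'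
    (f := fun x => κ.ker t (D.restrict t x) S)
    (((κ.ker t).measurable_coe hS).comp (D.measurable_restrict t))
  rw [κ.bind_total_eval_mem_inter hS hne h] at hzero
  simp only [κ.condProb_smul hS] at hzero
  rw [lintegral_eq_zero_iff (f := fun x₀ => κ.condProb S t x₀ * κ.condProb S t x₀)
    (hm.mul hm)] at hzero
  rw [κ.bind_total_eval_mem hS, lintegral_eq_zero_iff hm]
  filter_upwards [hzero] with x₀ hx
  exact mul_self_eq_zero.1 hx

end Independence

/-! ### The random parity coloring -/

/-- The parity of the number of ones in a vertex of the cube. -/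
noncomputable def parity (t : Cube) : ZMod 2 := t.sum fun _ b => b

/-- One of the two proper `2`-colorings of the cube, with colors `0` and `1`. -/
noncomputable def parityColoring (b : ZMod 2) (t : Cube) : I := if parity t + b = 0 then 0 else 1

/-- The law of a uniformly random proper `2`-coloring of the cube. -/
noncomputable def parityLaw : Measure (Cube → I) :=
  (2⁻¹ : ENNReal) • Measure.dirac (parityColoring 0) +
    (2⁻¹ : ENNReal) • Measure.dirac (parityColoring 1)

theorem parity_add_single (t : Cube) (i : ℕ) : parity (t + Finsupp.single i 1) = parity t + 1 := by
  unfold parity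
  rw [Finsupp.sum_add_index' (fun _ => rfl) (fun _ _ _ => rfl), Finsupp.sum_single_index rfl]

theorem parity_coordPerm (π : Equiv.Perm ℕ) (t : Cube) : parity (coordPerm π t) = parity t := by
  simp [parity, coordPerm, Finsupp.domCongr, Finsupp.sum_equivMapDomain]

/-- Every isometry either preserves or reverses the parity of all vertices. -/
theorem exists_parity_smul (γ : cubeIsom) : ∃ e, ∀ t : Cube, parity (γ • t) = parity t + e := by
  obtain ⟨g, hg⟩ := γ
  change ∃ e, ∀ t, parity (g t) = parity t + e
  induction hg using Subgroup.closure_induction with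
  | mem g hg =>
    rcases hg with ⟨π, -, rfl⟩ | ⟨i, rfl⟩
    · exact ⟨0, fun t => by rw [parity_coordPerm, add_zero]⟩
    · exact ⟨1, fun t => parity_add_single t i⟩
  | one => exact ⟨0, fun t => by simp⟩
  | mul g h _ _ hg hh =>
    obtain ⟨a, ha⟩ := hg
    obtain ⟨b, hb⟩ := hh
    exact ⟨b + a, fun t => by rw [Equiv.Perm.mul_apply, ha, hb, add_assoc]⟩
  | inv g _ hg =>
    obtain ⟨a, ha⟩ := hg
    refine ⟨-a, fun t => ?_⟩
    have := ha (g⁻¹ t)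
    rw [← Equiv.Perm.mul_apply, mul_inv_cancel, Equiv.Perm.one_apply] at this
    rw [this, add_neg_cancel_right]

theorem isExchangeable_parityLaw : IsExchangeable cubeIsom parityLaw := by
  refine ⟨⟨by simp [parityLaw, ENNReal.inv_two_add_inv_two]⟩, fun γ => ?_⟩
  obtain ⟨e, he⟩ := exists_parity_smul γ
  have hm : Measurable fun (ω : Cube → I) (t : Cube) => ω (γ • t) := by fun_prop
  have hcol : ∀ b, (fun t => parityColoring b (γ • t)) = parityColoring (e + b) := fun b => by
    funext t
    simp only [parityColoring, he, add_assoc]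
  have he2 : ∀ e : ZMod 2, e = 0 ∨ e = 1 := by decide
  simp only [parityLaw, Measure.map_add _ _ hm, Measure.map_smul, Measure.map_dirac' hm, hcol]
  rcases he2 e with rfl | rfl
  · simp only [zero_add]
  · rw [add_zero, CharTwo.add_self_eq_zero, add_comm]

theorem parity_flipIsom_smul (t : Cube) : parity (flipIsom 0 • t) = parity t + 1 :=
  parity_add_single t 0

theorem parityColoring_eq_zero_iff (b : ZMod 2) (t : Cube) :
    parityColoring b t = 0 ↔ parity t + b = 0 := by
  unfold parityColoring
  split_ifs with h <;> simp [h]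

theorem parityLaw_eval_zero : parityLaw {ω | ω 0 ∈ ({0} : Set I)} = 2⁻¹ := by
  have h0 : parity 0 = 0 := Finsupp.sum_zero_index
  simp [parityLaw, Set.indicator, parityColoring_eq_zero_iff, h0]

theorem parityLaw_eval_inter :
    parityLaw {ω | ω 0 ∈ ({0} : Set I) ∧ ω (flipIsom 0 • (0 : Cube)) ∈ ({0} : Set I)} = 0 := by
  have hproper : ∀ p b : ZMod 2, ¬ (p + b = 0 ∧ p + 1 + b = 0) := by decide
  simp [parityLaw, -not_and, Set.indicator, parityColoring_eq_zero_iff,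
    parity_flipIsom_smul, hproper]
  simpa using hproper (parity 0) 0

end CubeExchangeable

theorem corollary4p3 :
    ∃ μ : Measure (CubeExchangeable.Cube → I),
      CubeExchangeable.IsExchangeable CubeExchangeable.cubeIsom μ ∧
        ∀ D : CubeExchangeable.IndexData.{u} CubeExchangeable.cubeIsom CubeExchangeable.Cube,
          ¬ CubeExchangeable.RepresentableWith D μ := by
  open CubeExchangeable in
  refine ⟨parityLaw, isExchangeable_parityLaw, fun D hD => ?_⟩
  have hne : (0 : Cube) ≠ flipIsom 0 • (0 : Cube) := fun h => by
    have := parity_flipIsom_smul 0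
    rw [← h] at this
    simp at this
  have := hD.measure_eval_eq_zero (measurableSet_singleton 0) hne D.disjoint_dep
    parityLaw_eval_inter
  rw [parityLaw_eval_zero] at this
  simp at this
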